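/- Let $c>0$ and $a>0$, and endow the real line with the normalized double Gaussian density $$f(x)=\tfrac12\bigl(g_{c,a}(x)+g_{-c,a}(x)\bigr),\qquad g_{m,a}(x)=\frac{1}{a\sqrt{2\pi}}\,e^{-(x-m)^2/(2a^2)}$$ (for instance with $c=1$). For a Borel set $R\subseteq\mathbb R$ (a region), define its weighted volume $|R|=\int_R f(x)\,dx$ and its weighted perimeter $P(R)=\sum_{x\in\partial R} f(x)\in[0,\infty]$, where $\partial R$ is the topological boundary. Call $R$ isoperimetric if $P(R)\le P(S)$ for every Borel set $S$ with $|S|=|R|$. Then: 1. If $R$ is isoperimetric and $0<|R|<1$, then $\partial R$ consists of a single point $x$, and $R$ is a ray with endpoint $x$, that is, one of $(-\infty,x)$, $(-\infty,x]$, $(x,\infty)$, $[x,\infty)$. 2. Conversely, every ray, open or closed, is isoperimetric. In particular, isoperimetric regions of every weighted volume in $(0,1)$ exist. -/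

import Mathlib

open scoped ENNReal

/-- The double Gaussian density on the line with centers `c`, `-c` and common variance `a ^ 2`
(standard deviation `a`): the average of the two Gaussian densities. -/
noncomputable def doubleGaussian (c a : ℝ) (x : ℝ) : ℝ :=
  (1 / 2) * (ProbabilityTheory.gaussianPDFReal c (a ^ 2).toNNReal x
    + ProbabilityTheory.gaussianPDFReal (-c) (a ^ 2).toNNReal x)

/-- The weighted volume (weighted length) of a region `R` of the line with density `f`. -/
noncomputable def weightedVolume (f : ℝ → ℝ) (R : Set ℝ) : ℝ≥0∞ :=
  ∫⁻ x in R, ENNReal.ofReal (f x)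

/-- The weighted perimeter of `R`: the integral of the density over the topological boundary of
`R` against the zero-dimensional area measure, that is, the sum of the values of `f` over the
boundary points. The value is `∞` if this sum diverges. -/
noncomputable def weightedPerimeter (f : ℝ → ℝ) (R : Set ℝ) : ℝ≥0∞ :=
  ∑' x : frontier R, ENNReal.ofReal (f x)

/-- A (Borel) region `R` is isoperimetric if no other region of the same weighted volume has
smaller weighted perimeter. -/
def IsIsoperimetric (f : ℝ → ℝ) (R : Set ℝ) : Prop :=
  MeasurableSet R ∧ ∀ S : Set ℝ, MeasurableSet S → weightedVolume f S = weightedVolume f R →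
    weightedPerimeter f R ≤ weightedPerimeter f S

/-- `R` is a ray (open or closed, to the left or to the right) with endpoint `x`. -/
def IsRayAt (R : Set ℝ) (x : ℝ) : Prop :=
  R = Set.Iio x ∨ R = Set.Iic x ∨ R = Set.Ioi x ∨ R = Set.Ici x

open MeasureTheory ProbabilityTheory Set Filter Topology NNReal

/-! Volume and perimeter both split as averages over the two Gaussians. Write `Φ` for the
distribution function of the Gaussian centred at `c` and `I` for its isoperimetric profile, `I (Φ x)
= gaussianPDFReal c v x`; the other Gaussian is a translate, with the same profile. A left ray
ending at `z` has component volumes `Φ z` and `Φ (z + 2c)`. By Neyman–Pearson and reflection, a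
competitor of equal total volume has both component volumes at least `Φ z`, so its pair is less
spread out with the same sum. The one-Gaussian isoperimetric inequality in each component and
concavity of `I` give the bound (`doubleGaussian_perimeter_bound`). Strict concavity forces one
component volume of a minimizer to be `Φ z`, and equality in Neyman–Pearson makes it a ray up to a
null set. As the density is positive, its perimeter leaves room for only one boundary point, so it
is exactly a ray. -/

/-! ### Concavity and subadditivity of the Gaussian profile -/

theorem continuous_gaussianPDFReal (m : ℝ) (v : ℝ≥0) : Continuous (gaussianPDFReal m v) := by
  unfold gaussianPDFReal
  fun_prop

theorem hasDerivAt_gaussianPDFReal (m : ℝ) (v : ℝ≥0) (x : ℝ) :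
    HasDerivAt (gaussianPDFReal m v) ((m - x) / v * gaussianPDFReal m v x) x := by
  have h : HasDerivAt (fun y : ℝ => -(y - m) ^ 2 / (2 * v)) ((m - x) / v) x := by
    convert! ((((hasDerivAt_id x).sub_const m).pow 2).neg.div_const (2 * (v : ℝ))) using 1
    simp only [id, Nat.cast_ofNat]
    rw [show -(2 * (x - m) ^ (2 - 1) * 1) = 2 * (m - x) by ring, mul_div_mul_left _ _ two_ne_zero]
  convert! (h.exp.const_mul (√(2 * Real.pi * v))⁻¹) using 1
  simp only [gaussianPDFReal]
  ring

theorem hasDerivAt_gaussianReal_Iic (m : ℝ) {v : ℝ≥0} (hv : v ≠ 0) (x : ℝ) :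
    HasDerivAt (fun y => (gaussianReal m v).real (Iic y)) (gaussianPDFReal m v x) x := by
  have hi := integrable_gaussianPDFReal m v
  have hΦ : ∀ y, (gaussianReal m v).real (Iic y)
      = ∫ t in Iic y, gaussianPDFReal m v t := fun y => by
    rw [Measure.real, gaussianReal_apply_eq_integral m hv, ENNReal.toReal_ofReal]
    exact integral_nonneg fun t => gaussianPDFReal_nonneg m v t
  have hsub : (fun y => (gaussianReal m v).real (Iic y)) = fun y =>
      (gaussianReal m v).real (Iic 0) + ∫ t in (0 : ℝ)..y, gaussianPDFReal m v t := by
    funext y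
    rw [hΦ, hΦ, ← intervalIntegral.integral_Iic_sub_Iic hi.integrableOn hi.integrableOn]
    ring
  rw [hsub]
  have hc := continuous_gaussianPDFReal m v
  exact (intervalIntegral.integral_hasDerivAt_right (hc.intervalIntegrable _ _)
    (hc.stronglyMeasurableAtFilter _ _) hc.continuousAt).const_add _

theorem strictMono_gaussianReal_Iic (m : ℝ) {v : ℝ≥0} (hv : v ≠ 0) :
    StrictMono fun x => (gaussianReal m v).real (Iic x) :=
  strictMono_of_deriv_pos fun x => by
    rw [(hasDerivAt_gaussianReal_Iic m hv x).deriv]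
    exact gaussianPDFReal_pos m v x hv

theorem gaussianReal_Iic_pos (m : ℝ) {v : ℝ≥0} (hv : v ≠ 0) (x : ℝ) :
    0 < (gaussianReal m v).real (Iic x) :=
  lt_of_le_of_lt measureReal_nonneg (strictMono_gaussianReal_Iic m hv (sub_one_lt x))

/-- Strict concavity of the Gaussian isoperimetric profile, in tangent line form. -/
theorem gaussianPDFReal_lt_tangent (m : ℝ) {v : ℝ≥0} (hv : v ≠ 0) {x y : ℝ} (hxy : y ≠ x) :
    gaussianPDFReal m v y < gaussianPDFReal m v x
      + (m - x) / v * ((gaussianReal m v).real (Iic y) - (gaussianReal m v).real (Iic x)) := by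
  -- The derivative of `H` is `(x - t) / v` times a positive density, so `H` has its strict maximum
  -- at `x`.
  set H : ℝ → ℝ := fun t => gaussianPDFReal m v t - (m - x) / v * (gaussianReal m v).real (Iic t)
    with hH
  have hd : ∀ t, HasDerivAt H ((x - t) / v * gaussianPDFReal m v t) t := fun t => by
    convert! (hasDerivAt_gaussianPDFReal m v t).sub
      ((hasDerivAt_gaussianReal_Iic m hv t).const_mul ((m - x) / v)) using 1
    ring
  have hc : Continuous H := continuous_iff_continuousAt.2 fun t => (hd t).continuousAt
  have hv0 : (0 : ℝ) < v := by positivity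
  have key : H y < H x := by
    rcases lt_or_gt_of_ne hxy with h | h
    · refine strictMonoOn_of_deriv_pos (convex_Iic x) hc.continuousOn (fun t ht => ?_)
        h.le self_mem_Iic h
      rw [interior_Iic] at ht
      rw [(hd t).deriv]
      exact mul_pos (div_pos (sub_pos.2 ht) hv0) (gaussianPDFReal_pos m v t hv)
    · refine strictAntiOn_of_deriv_neg (convex_Ici x) hc.continuousOn (fun t ht => ?_)
        self_mem_Ici h.le h
      rw [interior_Ici] at ht
      rw [(hd t).deriv]
      exact mul_neg_of_neg_of_pos (div_neg_of_neg_of_pos (sub_neg.2 ht) hv0)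
        (gaussianPDFReal_pos m v t hv)
  simp only [hH] at key
  linarith

/-- The Mills ratio bound. -/
theorem mul_gaussianReal_Iic_le (m : ℝ) {v : ℝ≥0} (hv : v ≠ 0) (x : ℝ) :
    (m - x) / v * (gaussianReal m v).real (Iic x) ≤ gaussianPDFReal m v x := by
  have h0 : Tendsto (fun y => (gaussianReal m v).real (Iic y)) atBot (𝓝 0) := by
    exact (tendsto_cdf_atBot (gaussianReal m v)).congr fun y => cdf_eq_real _ y
  have h1 : Tendsto (fun y => gaussianPDFReal m v x
      + (m - x) / v * ((gaussianReal m v).real (Iic y) - (gaussianReal m v).real (Iic x))) atBot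
      (𝓝 (gaussianPDFReal m v x + (m - x) / v * (0 - (gaussianReal m v).real (Iic x)))) :=
    ((h0.sub_const _).const_mul _).const_add _
  -- The tangent line at `x` stays nonnegative as the volume `Φ y` tends to `0`.
  have := ge_of_tendsto h1 <| (eventually_lt_atBot x).mono fun y hy =>
    (gaussianPDFReal_nonneg m v y).trans (gaussianPDFReal_lt_tangent m hv hy.ne).le
  linarith

theorem gaussianPDFReal_le_of_abs_le (m : ℝ) (v : ℝ≥0) {x y : ℝ} (h : |y - m| ≤ |x - m|) :
    gaussianPDFReal m v x ≤ gaussianPDFReal m v y := by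
  unfold gaussianPDFReal
  have := sq_le_sq.2 h
  gcongr

theorem gaussianPDFReal_reflect (m : ℝ) (v : ℝ≥0) (x : ℝ) :
    gaussianPDFReal m v (2 * m - x) = gaussianPDFReal m v x := by
  unfold gaussianPDFReal
  congr 3
  ring

theorem gaussianReal_Ici (m : ℝ) (v : ℝ≥0) (x : ℝ) :
    (gaussianReal m v).real (Ici x) = (gaussianReal m v).real (Iic (2 * m - x)) := by
  have h : (gaussianReal m v).map (fun y => 2 * m - y) = gaussianReal m v := by
    rw [gaussianReal_map_const_sub]
    congr 1
    ring
  conv_lhs => rw [← h]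
  rw [map_measureReal_apply (by fun_prop) measurableSet_Ici]
  congr 1
  ext y
  simp only [mem_preimage, mem_Ici, mem_Iic]
  constructor <;> intro h <;> linarith

theorem gaussianReal_Iic_reflect (m : ℝ) {v : ℝ≥0} (hv : v ≠ 0) (x : ℝ) :
    (gaussianReal m v).real (Iic (2 * m - x)) = 1 - (gaussianReal m v).real (Iic x) := by
  have := nullSingletonClass_gaussianReal (μ := m) hv
  rw [← gaussianReal_Ici, ← measureReal_congr (Ioi_ae_eq_Ici (μ := gaussianReal m v) (a := x)),
    ← compl_Iic, probReal_compl_eq_one_sub measurableSet_Iic]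

/-- Concavity for two pairs of volumes with equal sums, the `y` pair lying strictly inside the `x`
pair: add the tangent bounds at `y₁` and `y₂`, whose slopes `(m - y) / v` decrease in `y`. -/
theorem gaussianPDFReal_add_lt_add (m : ℝ) {v : ℝ≥0} (hv : v ≠ 0) {x₁ x₂ y₁ y₂ : ℝ}
    (h₁ : x₁ < y₁) (h₂ : x₁ < y₂)
    (h : (gaussianReal m v).real (Iic x₁) + (gaussianReal m v).real (Iic x₂)
      = (gaussianReal m v).real (Iic y₁) + (gaussianReal m v).real (Iic y₂)) :
    gaussianPDFReal m v x₁ + gaussianPDFReal m v x₂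
      < gaussianPDFReal m v y₁ + gaussianPDFReal m v y₂ := by
  wlog hy : y₁ ≤ y₂ generalizing y₁ y₂
  · rw [add_comm (gaussianPDFReal m v y₁)]
    exact this h₂ h₁ (by linarith) (not_le.1 hy).le
  have hv0 : (0 : ℝ) < v := by positivity
  have hmono := strictMono_gaussianReal_Iic m hv
  have h3 := hmono h₁
  have h4 : y₂ < x₂ := hmono.lt_iff_lt.1 (by simp only at h3 ⊢; linarith)
  have t1 := gaussianPDFReal_lt_tangent m hv h₁.ne
  have t2 := gaussianPDFReal_lt_tangent m hv h4.ne'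
  have hs : (gaussianReal m v).real (Iic x₂) - (gaussianReal m v).real (Iic y₂)
      = -((gaussianReal m v).real (Iic x₁) - (gaussianReal m v).real (Iic y₁)) := by linarith
  rw [hs] at t2
  have hle : (m - y₂) / v ≤ (m - y₁) / v := by gcongr
  have := mul_nonneg (sub_nonneg.2 hle) (sub_nonneg.2 h3.le)
  simp only at this
  linarith

/-- Subadditivity of the profile on volumes up to one half. When `z` exceeds the larger point `y`,
the tangent at `y` costs at most `(m - y) / v * Φ x ≤ (m - x) / v * Φ x`, which the Mills bound
controls. -/
theorem gaussianPDFReal_le_add (m : ℝ) {v : ℝ≥0} (hv : v ≠ 0) {x y z : ℝ}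
    (hx : x ≤ m) (hy : y ≤ m) (hz : z ≤ m)
    (h : (gaussianReal m v).real (Iic z) ≤
      (gaussianReal m v).real (Iic x) + (gaussianReal m v).real (Iic y)) :
    gaussianPDFReal m v z ≤ gaussianPDFReal m v x + gaussianPDFReal m v y := by
  wlog hxy : x ≤ y generalizing x y
  · rw [add_comm]
    exact this hy hx (by linarith) (not_le.1 hxy).le
  have gx := gaussianPDFReal_nonneg m v x
  rcases le_or_gt z y with hzy | hzy
  · have := gaussianPDFReal_le_of_abs_le m v (x := z) (y := y)
      (by rw [abs_of_nonpos (by linarith), abs_of_nonpos (by linarith)]; linarith)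
    linarith
  have hv0 : (0 : ℝ) < v := by positivity
  have t := gaussianPDFReal_lt_tangent m hv hzy.ne'
  have hm := mul_gaussianReal_Iic_le m hv x
  have h0 : 0 ≤ (m - y) / v := div_nonneg (by linarith) hv0.le
  have hle : (m - y) / v ≤ (m - x) / v := by gcongr
  have h1 := mul_le_mul_of_nonneg_left (sub_le_iff_le_add.2 h) h0
  have h2 := mul_le_mul_of_nonneg_right hle (gaussianReal_Iic_pos m hv x).le
  linarith

/-! ### The isoperimetric inequality for one Gaussian -/

theorem csSup_inter_Iio_mem_frontier {S : Set ℝ} {m : ℝ} (hm : m ∉ S) (h : (S ∩ Iio m).Nonempty) :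
    sSup (S ∩ Iio m) ≤ m ∧ sSup (S ∩ Iio m) ∈ frontier S := by
  have hb : BddAbove (S ∩ Iio m) := ⟨m, fun t ht => ht.2.le⟩
  have hle : sSup (S ∩ Iio m) ≤ m := csSup_le h fun t ht => ht.2.le
  refine ⟨hle, ?_⟩
  rw [frontier_eq_closure_inter_closure]
  refine ⟨closure_mono inter_subset_left (csSup_mem_closure h hb), ?_⟩
  rcases hle.eq_or_lt with he | hlt
  · rw [he]
    exact subset_closure hm
  · have hsub : Ioo (sSup (S ∩ Iio m)) m ⊆ Sᶜ := fun t ht hS =>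
      (le_csSup hb ⟨hS, ht.2⟩).not_gt ht.1
    refine closure_mono hsub ?_
    rw [closure_Ioo hlt.ne]
    exact left_mem_Icc.2 hle

theorem csInf_inter_Ioi_mem_frontier {S : Set ℝ} {m : ℝ} (hm : m ∉ S) (h : (S ∩ Ioi m).Nonempty) :
    m ≤ sInf (S ∩ Ioi m) ∧ sInf (S ∩ Ioi m) ∈ frontier S := by
  have hb : BddBelow (S ∩ Ioi m) := ⟨m, fun t ht => ht.2.le⟩
  have hle : m ≤ sInf (S ∩ Ioi m) := le_csInf h fun t ht => ht.2.le
  refine ⟨hle, ?_⟩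
  rw [frontier_eq_closure_inter_closure]
  refine ⟨closure_mono inter_subset_left (csInf_mem_closure h hb), ?_⟩
  rcases hle.eq_or_lt with he | hlt
  · rw [← he]
    exact subset_closure hm
  · have hsub : Ioo m (sInf (S ∩ Ioi m)) ⊆ Sᶜ := fun t ht hS =>
      (csInf_le hb ⟨hS, ht.1⟩).not_gt ht.2
    refine closure_mono hsub ?_
    rw [closure_Ioo hlt.ne]
    exact right_mem_Icc.2 hle

theorem le_weightedPerimeter (f : ℝ → ℝ) {S : Set ℝ} {x : ℝ} (hx : x ∈ frontier S) :
    ENNReal.ofReal (f x) ≤ weightedPerimeter f S :=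
  ENNReal.le_tsum (f := fun y : frontier S => ENNReal.ofReal (f y)) ⟨x, hx⟩

theorem add_le_weightedPerimeter (f : ℝ → ℝ) {S : Set ℝ} {x y : ℝ} (hx : x ∈ frontier S)
    (hy : y ∈ frontier S) (hxy : x ≠ y) :
    ENNReal.ofReal (f x) + ENNReal.ofReal (f y) ≤ weightedPerimeter f S := by
  have hne : (⟨x, hx⟩ : frontier S) ≠ ⟨y, hy⟩ := fun h => hxy (congrArg Subtype.val h)
  have := ENNReal.sum_le_tsum (f := fun t : frontier S => ENNReal.ofReal (f t))
    {⟨x, hx⟩, ⟨y, hy⟩}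
  rwa [Finset.sum_pair hne] at this

theorem weightedPerimeter_compl (f : ℝ → ℝ) (S : Set ℝ) :
    weightedPerimeter f Sᶜ = weightedPerimeter f S := by
  unfold weightedPerimeter
  rw [frontier_compl]

/-- As `S` misses the mean, it lies in two rays ending at its frontier points nearest the mean on
either side. Reflecting the right ray reduces the claim to subadditivity. -/
theorem gaussianPDFReal_le_weightedPerimeter_of_notMem (m : ℝ) {v : ℝ≥0} (hv : v ≠ 0)
    {S : Set ℝ} {z : ℝ} (hm : m ∉ S) (hz : z ≤ m)
    (h : (gaussianReal m v).real (Iic z) ≤ (gaussianReal m v).real S) :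
    ENNReal.ofReal (gaussianPDFReal m v z) ≤ weightedPerimeter (gaussianPDFReal m v) S := by
  have hmono := strictMono_gaussianReal_Iic m hv
  have hg : ∀ t, z ≤ t → t ≤ m → gaussianPDFReal m v z ≤ gaussianPDFReal m v t :=
    fun t h1 h2 => gaussianPDFReal_le_of_abs_le m v (by
      rw [abs_of_nonpos (by linarith), abs_of_nonpos (by linarith)]; linarith)
  have hS : ∀ t ∈ S, t ∈ S ∩ Iio m ∨ t ∈ S ∩ Ioi m := fun t ht => by
    rcases lt_trichotomy t m with h | h | h
    · exact .inl ⟨ht, h⟩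
    · exact absurd (h ▸ ht) hm
    · exact .inr ⟨ht, h⟩
  have hA : ∀ t ∈ S ∩ Iio m, t ≤ sSup (S ∩ Iio m) := fun t ht =>
    le_csSup ⟨m, fun t ht => ht.2.le⟩ ht
  have hB : ∀ t ∈ S ∩ Ioi m, sInf (S ∩ Ioi m) ≤ t := fun t ht =>
    csInf_le ⟨m, fun t ht => ht.2.le⟩ ht
  rcases (S ∩ Iio m).eq_empty_or_nonempty with eA | nA <;>
    rcases (S ∩ Ioi m).eq_empty_or_nonempty with eB | nB
  · have : S = ∅ := eq_empty_of_forall_notMem fun t ht => by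
      have := hS t ht
      simp [eA, eB] at this
    rw [this, measureReal_empty] at h
    exact absurd h (gaussianReal_Iic_pos m hv z).not_ge
  · obtain ⟨hle, hfr⟩ := csInf_inter_Ioi_mem_frontier hm nB
    have hsub : S ⊆ Ici (sInf (S ∩ Ioi m)) := fun t ht =>
      hB t ((hS t ht).resolve_left (by simp [eA]))
    have h1 := h.trans (measureReal_mono hsub)
    rw [gaussianReal_Ici] at h1
    have := hg _ (hmono.le_iff_le.1 h1) (by linarith)
    rw [gaussianPDFReal_reflect] at this
    exact (ENNReal.ofReal_le_ofReal this).trans (le_weightedPerimeter _ hfr)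
  · obtain ⟨hle, hfr⟩ := csSup_inter_Iio_mem_frontier hm nA
    have hsub : S ⊆ Iic (sSup (S ∩ Iio m)) := fun t ht =>
      hA t ((hS t ht).resolve_right (by simp [eB]))
    have h1 := h.trans (measureReal_mono hsub)
    exact (ENNReal.ofReal_le_ofReal (hg _ (hmono.le_iff_le.1 h1) hle)).trans
      (le_weightedPerimeter _ hfr)
  · obtain ⟨hle, hfr⟩ := csSup_inter_Iio_mem_frontier hm nA
    obtain ⟨hle', hfr'⟩ := csInf_inter_Ioi_mem_frontier hm nB
    -- Coinciding endpoints would be counted once in the perimeter; they must equal `m`, where the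
    -- density is maximal.
    by_cases he : sSup (S ∩ Iio m) = sInf (S ∩ Ioi m)
    · have hm' : sSup (S ∩ Iio m) = m := le_antisymm hle (he ▸ hle')
      rw [hm'] at hfr
      exact (ENNReal.ofReal_le_ofReal (hg m hz le_rfl)).trans (le_weightedPerimeter _ hfr)
    have hsub : S ⊆ Iic (sSup (S ∩ Iio m)) ∪ Ici (sInf (S ∩ Ioi m)) := fun t ht =>
      (hS t ht).imp (hA t) (hB t)
    have h1 := (h.trans (measureReal_mono hsub)).trans (measureReal_union_le _ _)
    rw [gaussianReal_Ici] at h1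
    have := gaussianPDFReal_le_add m hv hle (by linarith) hz h1
    rw [gaussianPDFReal_reflect] at this
    refine (ENNReal.ofReal_le_ofReal this).trans ?_
    rw [ENNReal.ofReal_add (gaussianPDFReal_nonneg _ _ _) (gaussianPDFReal_nonneg _ _ _)]
    exact add_le_weightedPerimeter _ hfr hfr' he

/-- The Gaussian isoperimetric inequality on the line. -/
theorem gaussianPDFReal_le_weightedPerimeter (m : ℝ) {v : ℝ≥0} (hv : v ≠ 0)
    {S : Set ℝ} (hS : MeasurableSet S) {z : ℝ}
    (h : (gaussianReal m v).real (Iic z) = (gaussianReal m v).real S) :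
    ENNReal.ofReal (gaussianPDFReal m v z) ≤ weightedPerimeter (gaussianPDFReal m v) S := by
  wlog hm : m ∉ S generalizing S z
  · rw [← weightedPerimeter_compl, ← gaussianPDFReal_reflect]
    refine this hS.compl ?_ (fun h' => h' (not_not.1 hm))
    rw [gaussianReal_Iic_reflect m hv, probReal_compl_eq_one_sub hS, h]
  rcases le_total z m with hz | hz
  · exact gaussianPDFReal_le_weightedPerimeter_of_notMem m hv hm hz h.le
  -- The mirror point `2 * m - z` has the same density and no more volume to its left, so the
  -- inequality form of the volume hypothesis suffices.
  · rw [← gaussianPDFReal_reflect]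
    refine gaussianPDFReal_le_weightedPerimeter_of_notMem m hv hm (by linarith) (h ▸ ?_)
    exact (strictMono_gaussianReal_Iic m hv).monotone (by linarith)

/-! ### Comparing the two components -/

theorem gaussianReal_neg (m : ℝ) (v : ℝ≥0) {S : Set ℝ} (hS : MeasurableSet S) :
    (gaussianReal (-m) v).real S = (gaussianReal m v).real (Neg.neg ⁻¹' S) := by
  rw [← gaussianReal_map_neg, map_measureReal_apply measurable_neg hS]

theorem gaussianReal_neg_Iic (c : ℝ) (v : ℝ≥0) (x : ℝ) :
    (gaussianReal (-c) v).real (Iic x) = (gaussianReal c v).real (Iic (x + 2 * c)) := by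
  rw [show -c = c - 2 * c by ring, ← gaussianReal_map_sub_const,
    map_measureReal_apply (by fun_prop) measurableSet_Iic]
  congr 1
  ext t
  simp

theorem gaussianPDFReal_neg_eq (c : ℝ) (v : ℝ≥0) (x : ℝ) :
    gaussianPDFReal (-c) v x = gaussianPDFReal c v (x + 2 * c) := by
  unfold gaussianPDFReal
  congr 3
  ring

theorem gaussianPDFReal_eq_exp_mul (c : ℝ) {v : ℝ≥0} (hv : v ≠ 0) (x : ℝ) :
    gaussianPDFReal c v x = Real.exp (2 * c * x / v) * gaussianPDFReal (-c) v x := by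
  unfold gaussianPDFReal
  have hv0 : (v : ℝ) ≠ 0 := by exact_mod_cast hv
  rw [mul_left_comm, ← Real.exp_add]
  congr 2
  field_simp
  ring

/-- The Neyman–Pearson lemma for two Gaussians with equal variances. -/
theorem gaussianReal_Iic_le_of_add_eq {c : ℝ} (hc : 0 < c) {v : ℝ≥0} (hv : v ≠ 0) {S : Set ℝ}
    (hS : MeasurableSet S) {z : ℝ}
    (h : (gaussianReal c v).real S + (gaussianReal (-c) v).real S
      = (gaussianReal c v).real (Iic z) + (gaussianReal (-c) v).real (Iic z)) :
    (gaussianReal c v).real (Iic z) ≤ (gaussianReal c v).real S ∧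
      ((gaussianReal c v).real (Iic z) = (gaussianReal c v).real S → S =ᵐ[volume] Iic z) := by
  have hv0 : (0 : ℝ) < v := by positivity
  -- The likelihood ratio `exp (2 * c * t / v)` is increasing, so this combination changes sign
  -- exactly at `z`.
  set φ : ℝ → ℝ := fun t => gaussianPDFReal (-c) v z * gaussianPDFReal c v t
    - gaussianPDFReal c v z * gaussianPDFReal (-c) v t with hφ
  have hφ' : ∀ t, φ t = gaussianPDFReal (-c) v z * gaussianPDFReal (-c) v t
      * (Real.exp (2 * c * t / v) - Real.exp (2 * c * z / v)) := fun t => by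
    simp only [hφ]
    rw [gaussianPDFReal_eq_exp_mul c hv t, gaussianPDFReal_eq_exp_mul c hv z]
    ring
  have hpos : ∀ t, 0 < gaussianPDFReal (-c) v t := fun t => gaussianPDFReal_pos _ _ _ hv
  have hφpos : ∀ t, z < t → 0 < φ t := fun t ht => by
    rw [hφ']
    refine mul_pos (mul_pos (hpos z) (hpos t)) (sub_pos.2 (Real.exp_lt_exp.2 ?_))
    gcongr
  have hφneg : ∀ t, t < z → φ t < 0 := fun t ht => by
    rw [hφ']
    refine mul_neg_of_pos_of_neg (mul_pos (hpos z) (hpos t)) (sub_neg.2 (Real.exp_lt_exp.2 ?_))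
    gcongr
  have hi1 := (integrable_gaussianPDFReal c v).const_mul (gaussianPDFReal (-c) v z)
  have hi2 := (integrable_gaussianPDFReal (-c) v).const_mul (gaussianPDFReal c v z)
  have hi : Integrable φ := hi1.sub hi2
  have hint : ∀ T : Set ℝ, ∫ t in T, φ t = gaussianPDFReal (-c) v z * (gaussianReal c v).real T
      - gaussianPDFReal c v z * (gaussianReal (-c) v).real T := fun T => by
    have hr : ∀ m, (gaussianReal m v).real T = ∫ t in T, gaussianPDFReal m v t := fun m => by
      rw [Measure.real, gaussianReal_apply_eq_integral m hv, ENNReal.toReal_ofReal]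
      exact integral_nonneg fun t => gaussianPDFReal_nonneg m v t
    rw [hr, hr, ← integral_const_mul, ← integral_const_mul,
      ← integral_sub hi1.integrableOn hi2.integrableOn]
  set D : ℝ → ℝ := fun t => S.indicator φ t - (Iic z).indicator φ t with hD
  have hDi : Integrable D := (hi.indicator hS).sub (hi.indicator measurableSet_Iic)
  -- By `h`, the two components gain opposite volumes, which merges both terms into one with a
  -- positive factor.
  have hDint : ∫ t, D t = (gaussianPDFReal (-c) v z + gaussianPDFReal c v z)
      * ((gaussianReal c v).real S - (gaussianReal c v).real (Iic z)) := by
    rw [hD, integral_sub (hi.indicator hS) (hi.indicator measurableSet_Iic),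
      integral_indicator hS, integral_indicator measurableSet_Iic, hint, hint]
    linear_combination -(gaussianPDFReal c v z) * h
  have hD0 : 0 ≤ D := fun t => by
    have hz0 : φ z = 0 := by rw [hφ', sub_self, mul_zero]
    simp only [hD, indicator, mem_Iic, Pi.zero_apply]
    rcases lt_trichotomy t z with ht | rfl | ht
    · have := hφneg t ht
      split_ifs <;> linarith
    · simp [hz0]
    · have := hφpos t ht
      split_ifs <;> linarith
  have hgpos : 0 < gaussianPDFReal (-c) v z + gaussianPDFReal c v z :=
    add_pos (hpos z) (gaussianPDFReal_pos _ _ _ hv)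
  constructor
  · have := integral_nonneg (μ := volume) hD0
    rw [hDint] at this
    exact sub_nonneg.1 (nonneg_of_mul_nonneg_right this hgpos)
  · intro he
    rw [he, sub_self, mul_zero] at hDint
    filter_upwards [(integral_eq_zero_iff_of_nonneg hD0 hDi).1 hDint,
      (measure_eq_zero_iff_ae_notMem.1 (Real.volume_singleton (a := z)))] with t ht htz
    have hne : φ t ≠ 0 := by
      rcases lt_or_gt_of_ne (show t ≠ z from htz) with h | h
      · exact (hφneg t h).ne
      · exact (hφpos t h).ne'
    simp only [hD, indicator, Pi.zero_apply] at ht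
    refine propext ?_
    change t ∈ S ↔ t ∈ Iic z
    split_ifs at ht with h1 h2 h2
    · exact iff_of_true h1 h2
    · simp [hne] at ht
    · simp [hne] at ht
    · exact iff_of_false h1 h2

/-- Reflection in the origin swaps the two Gaussians, so the Neyman–Pearson bound for `-S` applies.
-/
theorem gaussianReal_Iic_le_of_add_eq' {c : ℝ} (hc : 0 < c) {v : ℝ≥0} (hv : v ≠ 0) {S : Set ℝ}
    (hS : MeasurableSet S) {z : ℝ}
    (h : (gaussianReal c v).real S + (gaussianReal (-c) v).real S
      = (gaussianReal c v).real (Iic z) + (gaussianReal (-c) v).real (Iic z)) :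
    (gaussianReal c v).real (Iic z) ≤ (gaussianReal (-c) v).real S ∧
      ((gaussianReal c v).real (Iic z) = (gaussianReal (-c) v).real S →
        S =ᵐ[volume] Ici (-z)) := by
  have h1 := gaussianReal_neg c v hS
  have h2 := gaussianReal_neg (-c) v hS
  rw [neg_neg] at h2
  obtain ⟨hle, heq⟩ := gaussianReal_Iic_le_of_add_eq hc hv (hS.preimage measurable_neg) (z := z)
    (by rw [← h1, ← h2, ← h, add_comm])
  rw [← h1] at hle heq
  refine ⟨hle, fun he => ?_⟩
  have := (Measure.measurePreserving_neg (volume : Measure ℝ)).quasiMeasurePreserving.preimage_ae_eq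
    (heq he)
  simpa using this

/-- Among the regions with the volume of a ray, the perimeter is at least that of the ray, with
equality only for rays up to null sets. -/
theorem doubleGaussian_perimeter_bound {c : ℝ} (hc : 0 < c) {v : ℝ≥0} (hv : v ≠ 0) {S : Set ℝ}
    (hS : MeasurableSet S) {z : ℝ}
    (h : (gaussianReal c v).real S + (gaussianReal (-c) v).real S
      = (gaussianReal c v).real (Iic z) + (gaussianReal (-c) v).real (Iic z)) :
    ∃ p q : ℝ, 0 ≤ p ∧ 0 ≤ q ∧
      ENNReal.ofReal p ≤ weightedPerimeter (gaussianPDFReal c v) S ∧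
      ENNReal.ofReal q ≤ weightedPerimeter (gaussianPDFReal (-c) v) S ∧
      gaussianPDFReal c v z + gaussianPDFReal (-c) v z ≤ p + q ∧
      (p + q ≤ gaussianPDFReal c v z + gaussianPDFReal (-c) v z →
        S =ᵐ[volume] Iic z ∨ S =ᵐ[volume] Ici (-z)) := by
  have hmono := strictMono_gaussianReal_Iic c hv
  have hcont : Continuous fun x => (gaussianReal c v).real (Iic x) :=
    continuous_iff_continuousAt.2 fun x => (hasDerivAt_gaussianReal_Iic c hv x).continuousAt
  obtain ⟨hle, heq⟩ := gaussianReal_Iic_le_of_add_eq hc hv hS h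
  obtain ⟨hle', heq'⟩ := gaussianReal_Iic_le_of_add_eq' hc hv hS h
  have h' := h
  rw [gaussianReal_neg_Iic] at h
  -- Each component volume is at most `Φ (z + 2 * c)`, because the other is at least `Φ z`.
  obtain ⟨y₁, hy₁⟩ := mem_range_of_exists_le_of_exists_ge hcont (c := (gaussianReal c v).real S)
    ⟨z, hle⟩ ⟨z + 2 * c, by linarith⟩
  obtain ⟨y₂, hy₂⟩ := mem_range_of_exists_le_of_exists_ge hcont
    (c := (gaussianReal (-c) v).real S) ⟨z, hle'⟩ ⟨z + 2 * c, by linarith⟩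
  simp only at hy₁ hy₂
  have hz₁ : z ≤ y₁ := hmono.le_iff_le.1 (hle.trans_eq hy₁.symm)
  have hz₂ : z ≤ y₂ := hmono.le_iff_le.1 (hle'.trans_eq hy₂.symm)
  rw [← hy₁, ← hy₂] at h
  rw [← hy₁] at heq
  rw [← hy₂] at heq'
  refine ⟨gaussianPDFReal c v y₁, gaussianPDFReal (-c) v (y₂ - 2 * c), gaussianPDFReal_nonneg _ _ _,
    gaussianPDFReal_nonneg _ _ _, gaussianPDFReal_le_weightedPerimeter c hv hS hy₁,
    gaussianPDFReal_le_weightedPerimeter (-c) hv hS ?_, ?_⟩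
  · rw [gaussianReal_neg_Iic, sub_add_cancel, hy₂]
  rw [gaussianPDFReal_neg_eq, gaussianPDFReal_neg_eq, sub_add_cancel]
  rcases hz₁.eq_or_lt with rfl | hlt₁
  · have : y₂ = z + 2 * c := hmono.injective (by linarith)
    rw [this]
    exact ⟨le_rfl, fun _ => .inl (heq rfl)⟩
  rcases hz₂.eq_or_lt with rfl | hlt₂
  · have : y₁ = z + 2 * c := hmono.injective (by linarith)
    rw [this, add_comm]
    exact ⟨le_rfl, fun _ => .inr (heq' rfl)⟩
  have := gaussianPDFReal_add_lt_add c hv hlt₁ hlt₂ h.symm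
  exact ⟨this.le, fun h => absurd this h.not_gt⟩

/-! ### Transfer to the double Gaussian density -/

theorem doubleGaussian_pos (c : ℝ) {a : ℝ} (ha : 0 < a) (x : ℝ) : 0 < doubleGaussian c a x := by
  have hv : (a ^ 2).toNNReal ≠ 0 := by positivity
  have h1 := gaussianPDFReal_pos c _ x hv
  have h2 := gaussianPDFReal_pos (-c) _ x hv
  unfold doubleGaussian
  positivity

theorem doubleGaussian_neg (c a x : ℝ) : doubleGaussian c a (-x) = doubleGaussian c a x := by
  have h : ∀ m v, gaussianPDFReal m v (-x) = gaussianPDFReal (-m) v x := fun m v => by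
    unfold gaussianPDFReal
    congr 3
    ring
  unfold doubleGaussian
  rw [h, h, neg_neg, add_comm]

theorem ofReal_half_mul_add {p q : ℝ} (hp : 0 ≤ p) (hq : 0 ≤ q) :
    ENNReal.ofReal (1 / 2 * (p + q)) = 2⁻¹ * (ENNReal.ofReal p + ENNReal.ofReal q) := by
  rw [ENNReal.ofReal_mul (by norm_num), ENNReal.ofReal_add hp hq, one_div,
    ENNReal.ofReal_inv_of_pos two_pos, ENNReal.ofReal_ofNat]

theorem weightedVolume_doubleGaussian (c : ℝ) {a : ℝ} (ha : 0 < a) (S : Set ℝ) :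
    weightedVolume (doubleGaussian c a) S = ENNReal.ofReal (1 / 2 *
      ((gaussianReal c (a ^ 2).toNNReal).real S + (gaussianReal (-c) (a ^ 2).toNNReal).real S)) := by
  have hv : (a ^ 2).toNNReal ≠ 0 := by positivity
  rw [ofReal_half_mul_add measureReal_nonneg measureReal_nonneg, ofReal_measureReal,
    ofReal_measureReal, gaussianReal_apply _ hv, gaussianReal_apply _ hv,
    ← lintegral_add_left (measurable_gaussianPDF _ _), ← lintegral_const_mul' _ _ (by simp)]
  exact lintegral_congr fun t => ofReal_half_mul_add (gaussianPDFReal_nonneg _ _ _)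
    (gaussianPDFReal_nonneg _ _ _)

theorem weightedPerimeter_doubleGaussian (c a : ℝ) (S : Set ℝ) :
    weightedPerimeter (doubleGaussian c a) S =
      2⁻¹ * (weightedPerimeter (gaussianPDFReal c (a ^ 2).toNNReal) S
        + weightedPerimeter (gaussianPDFReal (-c) (a ^ 2).toNNReal) S) := by
  unfold weightedPerimeter
  rw [← ENNReal.tsum_add, ← ENNReal.tsum_mul_left]
  exact tsum_congr fun t => ofReal_half_mul_add (gaussianPDFReal_nonneg _ _ _)
    (gaussianPDFReal_nonneg _ _ _)

theorem doubleGaussian_le_weightedPerimeter {c a : ℝ} (hc : 0 < c) (ha : 0 < a) {S : Set ℝ}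
    (hS : MeasurableSet S) {z : ℝ}
    (h : weightedVolume (doubleGaussian c a) S = weightedVolume (doubleGaussian c a) (Iic z)) :
    ENNReal.ofReal (doubleGaussian c a z) ≤ weightedPerimeter (doubleGaussian c a) S ∧
      (weightedPerimeter (doubleGaussian c a) S ≤ ENNReal.ofReal (doubleGaussian c a z) →
        S =ᵐ[volume] Iic z ∨ S =ᵐ[volume] Ici (-z)) := by
  have hv : (a ^ 2).toNNReal ≠ 0 := by positivity
  rw [weightedVolume_doubleGaussian c ha, weightedVolume_doubleGaussian c ha,
    ENNReal.ofReal_eq_ofReal_iff (by positivity) (by positivity)] at h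
  obtain ⟨p, q, hp, hq, hpP, hqP, hle, heq⟩ :=
    doubleGaussian_perimeter_bound hc hv hS (z := z) (by linarith)
  have hbound : ENNReal.ofReal (1 / 2 * (p + q)) ≤ weightedPerimeter (doubleGaussian c a) S := by
    rw [weightedPerimeter_doubleGaussian, ofReal_half_mul_add hp hq]
    gcongr
  constructor
  · refine (ENNReal.ofReal_le_ofReal ?_).trans hbound
    unfold doubleGaussian
    linarith
  · intro hP
    have := (ENNReal.ofReal_le_ofReal_iff (doubleGaussian_pos c ha z).le).1 (hbound.trans hP)
    unfold doubleGaussian at this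
    exact heq (by linarith)

/-! ### From almost everywhere equality to rays -/

theorem IsRayAt.compl {R : Set ℝ} {x : ℝ} (h : IsRayAt R x) : IsRayAt Rᶜ x := by
  rcases h with rfl | rfl | rfl | rfl <;> simp [IsRayAt]

theorem IsRayAt.frontier_eq {R : Set ℝ} {x : ℝ} (h : IsRayAt R x) : frontier R = {x} := by
  rcases h with rfl | rfl | rfl | rfl <;> simp

theorem subset_or_disjoint_of_frontier_disjoint {S U : Set ℝ} (hU : IsPreconnected U)
    (h : Disjoint (frontier S) U) : U ⊆ S ∨ Disjoint U S := by
  have hsub : U ⊆ interior S ∪ (closure S)ᶜ := fun t ht => by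
    by_contra hn
    simp only [mem_union, mem_compl_iff, not_or, not_not] at hn
    exact h.le_bot ⟨⟨hn.2, hn.1⟩, ht⟩
  rcases hU.subset_or_subset isOpen_interior isClosed_closure.isOpen_compl
    (disjoint_compl_right.mono_left interior_subset_closure) hsub with h | h
  · exact .inl (h.trans interior_subset)
  · exact .inr (disjoint_of_subset_right subset_closure (disjoint_left.2 h))

/-- Otherwise an interval around `x` lies in `S` or misses it, and one of its halves is a non-null
discrepancy with the ray. -/
theorem mem_frontier_of_ae_eq_Iic {S : Set ℝ} {x : ℝ} (h : S =ᵐ[volume] Iic x) :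
    x ∈ frontier S := by
  by_contra hx
  have hpos : ∀ U : Set ℝ, IsOpen U → U.Nonempty → volume U ≠ 0 := fun U hU hn =>
    (hU.measure_pos _ hn).ne'
  obtain ⟨ε, hε, hball⟩ := Metric.isOpen_iff.1 isClosed_frontier.isOpen_compl x hx
  rw [Real.ball_eq_Ioo] at hball
  rcases subset_or_disjoint_of_frontier_disjoint isPreconnected_Ioo
    (disjoint_left.2 fun t ht hU => hball hU ht) with hs | hs
  · refine hpos (Ioo x (x + ε)) isOpen_Ioo (nonempty_Ioo.2 (by linarith))
      (measure_mono_null ?_ (ae_le_set.1 h.le))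
    exact fun t ht => ⟨hs ⟨by linarith [ht.1], ht.2⟩, ht.1.not_ge⟩
  · refine hpos (Ioo (x - ε) x) isOpen_Ioo (nonempty_Ioo.2 (by linarith))
      (measure_mono_null ?_ (ae_le_set.1 h.symm.le))
    exact fun t ht => ⟨ht.2.le, fun hS => hs.le_bot ⟨⟨ht.1, by linarith [ht.2]⟩, hS⟩⟩

theorem isRayAt_of_ae_eq_Iic {S : Set ℝ} {x : ℝ} (h : S =ᵐ[volume] Iic x)
    (hfr : frontier S = {x}) : IsRayAt S x := by
  have hpos : ∀ U : Set ℝ, IsOpen U → U.Nonempty → volume U ≠ 0 := fun U hU hn =>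
    (hU.measure_pos _ hn).ne'
  have hl : Iio x ⊆ S := by
    refine (subset_or_disjoint_of_frontier_disjoint isPreconnected_Iio
      (by simp [hfr])).resolve_right fun hs => ?_
    have hsub : Iio x ⊆ Iic x \ S := fun t (ht : t < x) => ⟨ht.le, fun hS => hs.le_bot ⟨ht, hS⟩⟩
    exact hpos _ isOpen_Iio nonempty_Iio (measure_mono_null hsub (ae_le_set.1 h.symm.le))
  have hr : Disjoint (Ioi x) S := by
    refine (subset_or_disjoint_of_frontier_disjoint isPreconnected_Ioi
      (by simp [hfr])).resolve_left fun hs => ?_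
    have hsub : Ioi x ⊆ S \ Iic x := fun t (ht : x < t) => ⟨hs ht, ht.not_ge⟩
    exact hpos _ isOpen_Ioi nonempty_Ioi (measure_mono_null hsub (ae_le_set.1 h.le))
  have hle : S ⊆ Iic x := fun t ht =>
    not_lt.1 fun hlt : x < t => hr.le_bot ⟨hlt, ht⟩
  by_cases hx : x ∈ S
  · refine .inr (.inl (hle.antisymm fun t ht => ?_))
    rcases (mem_Iic.1 ht).eq_or_lt with rfl | hlt
    · exact hx
    · exact hl hlt
  · exact .inl (Subset.antisymm (fun t ht => (hle ht).lt_of_ne fun he : t = x => hx (he ▸ ht)) hl)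

theorem frontier_eq_singleton_of_weightedPerimeter_le {f : ℝ → ℝ} (hf : ∀ x, 0 < f x) {S : Set ℝ}
    {x : ℝ} (hx : x ∈ frontier S) (h : weightedPerimeter f S ≤ ENNReal.ofReal (f x)) :
    frontier S = {x} := by
  refine Subset.antisymm (fun y hy => ?_) (singleton_subset_iff.2 hx)
  by_contra hne
  have h1 := (add_le_weightedPerimeter f hx hy (Ne.symm hne)).trans h
  rw [← ENNReal.ofReal_add (hf x).le (hf y).le, ENNReal.ofReal_le_ofReal_iff (hf x).le] at h1
  linarith [hf y]

theorem isRayAt_of_weightedPerimeter_le {f : ℝ → ℝ} (hf : ∀ x, 0 < f x) {S : Set ℝ} {x : ℝ}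
    (hS : S =ᵐ[volume] Iic x) (h : weightedPerimeter f S ≤ ENNReal.ofReal (f x)) :
    frontier S = {x} ∧ IsRayAt S x :=
  have hfr := frontier_eq_singleton_of_weightedPerimeter_le hf (mem_frontier_of_ae_eq_Iic hS) h
  ⟨hfr, isRayAt_of_ae_eq_Iic hS hfr⟩

/-! ### Rays as competitors, and the theorem -/

theorem IsRayAt.weightedPerimeter_eq (f : ℝ → ℝ) {R : Set ℝ} {x : ℝ} (h : IsRayAt R x) :
    weightedPerimeter f R = ENNReal.ofReal (f x) := by
  unfold weightedPerimeter
  rw [h.frontier_eq]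
  exact tsum_singleton x fun y => ENNReal.ofReal (f y)

theorem weightedVolume_doubleGaussian_Ici (c : ℝ) {a : ℝ} (ha : 0 < a) (x : ℝ) :
    weightedVolume (doubleGaussian c a) (Ici x) = weightedVolume (doubleGaussian c a) (Iic (-x)) := by
  rw [weightedVolume_doubleGaussian c ha, weightedVolume_doubleGaussian c ha,
    gaussianReal_neg c _ measurableSet_Ici, gaussianReal_neg c _ measurableSet_Iic,
    neg_preimage, neg_preimage, neg_Ici, neg_Iic, neg_neg, add_comm]

theorem IsRayAt.exists_weightedVolume_eq (c : ℝ) {a : ℝ} (ha : 0 < a) {R : Set ℝ} {x : ℝ}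
    (h : IsRayAt R x) : ∃ z, doubleGaussian c a z = doubleGaussian c a x ∧
      weightedVolume (doubleGaussian c a) R = weightedVolume (doubleGaussian c a) (Iic z) := by
  rcases h with rfl | rfl | rfl | rfl
  · exact ⟨x, rfl, setLIntegral_congr Iio_ae_eq_Iic⟩
  · exact ⟨x, rfl, rfl⟩
  · exact ⟨-x, doubleGaussian_neg c a x, (setLIntegral_congr Ioi_ae_eq_Ici).trans
      (weightedVolume_doubleGaussian_Ici c ha x)⟩
  · exact ⟨-x, doubleGaussian_neg c a x, weightedVolume_doubleGaussian_Ici c ha x⟩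

theorem exists_weightedVolume_Iic_eq (c : ℝ) {a : ℝ} (ha : 0 < a) {t : ℝ≥0∞} (h0 : 0 < t)
    (h1 : t < 1) : ∃ z, weightedVolume (doubleGaussian c a) (Iic z) = t := by
  have hv : (a ^ 2).toNNReal ≠ 0 := by positivity
  have ht : t ≠ ∞ := h1.ne_top
  have hlim : ∀ m : ℝ, ∀ l L, Tendsto (cdf (gaussianReal m (a ^ 2).toNNReal)) l (𝓝 L) →
      Tendsto (fun x => (gaussianReal m (a ^ 2).toNNReal).real (Iic x)) l (𝓝 L) := fun m l L h =>
    h.congr fun y => cdf_eq_real _ y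
  have hcont : ∀ m : ℝ, Continuous fun x => (gaussianReal m (a ^ 2).toNNReal).real (Iic x) :=
    fun m => continuous_iff_continuousAt.2 fun x =>
      (hasDerivAt_gaussianReal_Iic m hv x).continuousAt
  have hbot := ((hlim c _ _ (tendsto_cdf_atBot _)).add
    (hlim (-c) _ _ (tendsto_cdf_atBot _))).const_mul (1 / 2)
  have htop := ((hlim c _ _ (tendsto_cdf_atTop _)).add
    (hlim (-c) _ _ (tendsto_cdf_atTop _))).const_mul (1 / 2)
  have ht0 : 1 / 2 * ((0 : ℝ) + 0) < t.toReal := by simpa using ENNReal.toReal_pos h0.ne' ht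
  have ht1 : t.toReal < 1 / 2 * ((1 : ℝ) + 1) := by
    have := (ENNReal.toReal_lt_toReal ht ENNReal.one_ne_top).2 h1
    norm_num at this ⊢
    exact this
  obtain ⟨z, hz⟩ := mem_range_of_exists_le_of_exists_ge
    (((hcont c).add (hcont (-c))).const_mul (1 / 2))
    ((hbot.eventually_le_const ht0).exists) ((htop.eventually_const_le ht1).exists)
  refine ⟨z, ?_⟩
  rw [weightedVolume_doubleGaussian c ha]
  exact (congrArg ENNReal.ofReal hz).trans (ENNReal.ofReal_toReal ht)

theorem theorem2p18 (c a : ℝ) (hc : 0 < c) (ha : 0 < a) :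
    (∀ R : Set ℝ, IsIsoperimetric (doubleGaussian c a) R →
      0 < weightedVolume (doubleGaussian c a) R → weightedVolume (doubleGaussian c a) R < 1 →
      ∃ x : ℝ, frontier R = {x} ∧ IsRayAt R x) ∧
    (∀ (R : Set ℝ) (x : ℝ), IsRayAt R x → IsIsoperimetric (doubleGaussian c a) R) := by
  have hf := doubleGaussian_pos c ha
  constructor
  · rintro R ⟨hR, hmin⟩ h0 h1
    obtain ⟨z, hz⟩ := exists_weightedVolume_Iic_eq c ha h0 h1
    have hP := hmin (Iic z) measurableSet_Iic hz
    rw [IsRayAt.weightedPerimeter_eq (x := z) _ (.inr (.inl rfl))] at hP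
    rcases (doubleGaussian_le_weightedPerimeter hc ha hR hz.symm).2 hP with h | h
    · exact ⟨z, isRayAt_of_weightedPerimeter_le hf h hP⟩
    -- A right ray is handled through its complement, which has the same frontier and perimeter.
    · have hIci : ((Ici (-z))ᶜ : Set ℝ) =ᵐ[volume] Iic (-z) := by
        rw [compl_Ici]
        exact Iio_ae_eq_Iic
      have hcompl : (Rᶜ : Set ℝ) =ᵐ[volume] Iic (-z) := (ae_eq_set_compl_compl.2 h).trans hIci
      rw [← doubleGaussian_neg, ← weightedPerimeter_compl] at hP
      have := isRayAt_of_weightedPerimeter_le hf hcompl hP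
      exact ⟨-z, by rw [← frontier_compl, this.1], by simpa using this.2.compl⟩
  · intro R x hR
    refine ⟨?_, fun S hS hvol => ?_⟩
    · rcases hR with rfl | rfl | rfl | rfl <;> measurability
    · obtain ⟨z, hz, hvz⟩ := hR.exists_weightedVolume_eq c ha
      rw [hR.weightedPerimeter_eq, ← hz]
      exact (doubleGaussian_le_weightedPerimeter hc ha hS (hvol.trans hvz)).1
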